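/- **Setting.** Let $I$ be a finite index set and let $A=(a_{ij})_{i,j\in I}$ be an E-generalized Cartan matrix: a real matrix with $a_{ii}=2$ for all $i$, $a_{ij}\le 0$ for $i\ne j$, $a_{ji}\neq 0$ whenever $a_{ij}\ne 0$, and such that for all $i\neq j$ either $a_{ij}a_{ji}\ge 4$ or $a_{ij}a_{ji}=4\cos^2(\pi/k)$ for some integer $k\ge 2$. For $i\ne j$ put $m_{ij}=k$ in the latter case and $m_{ij}=\infty$ in the former. Let $W$ be the Coxeter group with identity $\varepsilon$, generators $(s_i)_{i\in I}$ and relations $s_i^2=\varepsilon$ and $(s_is_j)^{m_{ij}}=\varepsilon$ for $i\neq j$ (no relation if $m_{ij}=\infty$). Let $V$ be the real vector space with basis $(\alpha_i)_{i\in I}$, with the (possibly asymmetric) bilinear form $B(\alpha_i,\alpha_j)=\tfrac12 a_{ij}$, and let $W$ act linearly on $V$ by $s_i.v=v-2B(\alpha_i,v)\alpha_i$. Write $\gamma_i$ $(i\in I)$ for the nodes of the associated graph. For $i\neq j$ with $m_{ij}$ odd (*odd neighbors*), put $v_{ji}=(s_is_j)^{(m_{ij}-1)/2}$ and $K_{ji}=\dfrac{-a_{ji}}{2\cos(\pi/m_{ij})}$.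 For $i\ne j$ with $m_{ij}$ finite and even (*even-related*), put $v_{ji}=s_j(s_is_j)^{(m_{ij}-2)/2}$. An *ON-path* of length $p\ge 0$ is a sequence $\mathcal P=[\gamma_{i_0},\dots,\gamma_{i_p}]$ of nodes in which consecutive nodes are odd neighbors; put $w_{\mathcal P}=v_{i_pi_{p-1}}\cdots v_{i_1i_0}$ and $\Pi_{\mathcal P}=K_{i_pi_{p-1}}\cdots K_{i_1i_0}$ (equal to $\varepsilon$ and $1$ if $p=0$). An *ER-sequence* rooted at $\gamma_r$ is a finite, possibly empty, sequence $\mathcal S=[(\gamma_r,\gamma_{j_1}),\dots,(\gamma_r,\gamma_{j_q})]$ with $\gamma_r$ and $\gamma_{j_k}$ even-related for every $k$; put $w_{\mathcal S}=v_{j_qr}\cdots v_{j_1r}$ (equal to $\varepsilon$ if $q=0$). **Theorem.** Let $w\in W$ with $w\ne\varepsilon$, and let $i,x\in I$. (1) There is a real $K>0$ with $w.\alpha_i=K\alpha_x$ if and only if there are an ON-path $\mathcal P=[\gamma_{i_0=i},\gamma_{i_1},\dots,\gamma_{i_p=x}]$ and ER-sequences $\mathcal S_k$ rooted at $\gamma_{i_k}$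 $(0\le k\le p)$ such that $$w=w_{\mathcal S_p}\,v_{i_pi_{p-1}}\,w_{\mathcal S_{p-1}}\cdots v_{i_2i_1}\,w_{\mathcal S_1}\,v_{i_1i_0}\,w_{\mathcal S_0}.$$ In this case, for every such $\mathcal P$ and $(\mathcal S_k)$, $w.\alpha_i=w_{\mathcal P}.\alpha_i=\Pi_{\mathcal P}\,\alpha_x$, so that $K=\Pi_{\mathcal P}$. (2) There is a real $K<0$ with $w.\alpha_i=K\alpha_x$ if and only if there are an ON-path $\mathcal P=[\gamma_{i_0=i},\gamma_{i_1},\dots,\gamma_{i_p=x}]$ and ER-sequences $\mathcal S_k$ rooted at $\gamma_{i_k}$ $(0\le k\le p)$ such that $$w=w_{\mathcal S_p}\,v_{i_pi_{p-1}}\,w_{\mathcal S_{p-1}}\cdots v_{i_2i_1}\,w_{\mathcal S_1}\,v_{i_1i_0}\,w_{\mathcal S_0}\,s_i.$$ In this case, for every such $\mathcal P$ and $(\mathcal S_k)$, $w.\alpha_i=(w_{\mathcal P}s_i).\alpha_i=-\Pi_{\mathcal P}\,\alpha_x$, so that $K=-\Pi_{\mathcal P}$. -/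

import Mathlib

/-- An E-generalized Cartan matrix with index set `ι`: a real square matrix with diagonal entries
`2`, nonpositive off-diagonal entries, `a i j ≠ 0 → a j i ≠ 0`, and, for `i ≠ j`, either
`4 ≤ a i j * a j i` or `a i j * a j i = 4 cos² (π / k)` for some integer `k ≥ 2`. -/
structure EGCM (ι : Type*) where
  a : Matrix ι ι ℝ
  diag : ∀ i, a i i = 2
  nonpos : ∀ i j, i ≠ j → a i j ≤ 0
  ne_zero : ∀ i j, a i j ≠ 0 → a j i ≠ 0
  transpose_mul : ∀ i j, i ≠ j →
    4 ≤ a i j * a j i ∨ ∃ k : ℕ, 2 ≤ k ∧ a i j * a j i = 4 * Real.cos (Real.pi / k) ^ 2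

noncomputable section

namespace EGCM

variable {ι : Type*} [DecidableEq ι]

/-- The exponents `m i j`: `1` on the diagonal; for `i ≠ j`, the integer `k ≥ 2` with
`a i j * a j i = 4 cos² (π / k)` if there is one (it is then unique), and otherwise (that is, if
`4 ≤ a i j * a j i`) the infimum of the empty set of naturals, which is `0` and stands for `∞`
as everywhere in Mathlib's `CoxeterMatrix`. -/
def m (A : EGCM ι) (i j : ι) : ℕ :=
  if i = j then 1
  else sInf {k : ℕ | 2 ≤ k ∧ A.a i j * A.a j i = 4 * Real.cos (Real.pi / k) ^ 2}

/-- For `i ≠ j`, a nonzero `m i j` is an integer `k ≥ 2` with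
`a i j * a j i = 4 cos² (π / k)`. -/
theorem m_spec (A : EGCM ι) {i j : ι} (hij : i ≠ j) (h : A.m i j ≠ 0) :
    2 ≤ A.m i j ∧ A.a i j * A.a j i = 4 * Real.cos (Real.pi / (A.m i j)) ^ 2 := by
  have hm : A.m i j =
      sInf {k : ℕ | 2 ≤ k ∧ A.a i j * A.a j i = 4 * Real.cos (Real.pi / k) ^ 2} := by
    simp [m, hij]
  have hne : {k : ℕ | 2 ≤ k ∧ A.a i j * A.a j i = 4 * Real.cos (Real.pi / k) ^ 2}.Nonempty := by
    apply Nat.nonempty_of_pos_sInf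
    omega
  have := Nat.sInf_mem hne
  rw [← hm] at this
  exact this

/-- The Coxeter matrix `(m i j)` of `A`. -/
def coxeterMatrix (A : EGCM ι) : CoxeterMatrix ι where
  M := Matrix.of A.m
  isSymm := by
    ext i j
    simp only [Matrix.transpose_apply, Matrix.of_apply, m, mul_comm (A.a j i), eq_comm (a := j)]
  diagonal i := by simp [m]
  off_diagonal i j hij h := by
    have h' : A.m i j = 1 := h
    have := (A.m_spec hij (by omega)).1
    omega

/-- The Coxeter group `W` with generators `s i` and relations `(s i) ^ 2 = 1` and
`(s i * s j) ^ (m i j) = 1`. -/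
abbrev W (A : EGCM ι) : Type _ := A.coxeterMatrix.Group

/-- The generators of `W`. -/
abbrev s (A : EGCM ι) (i : ι) : A.W := A.coxeterMatrix.simple i

variable [Fintype ι]

/-- The simple roots, which are a basis of `V = ι → ℝ`. -/
def α (_A : EGCM ι) (i : ι) : ι → ℝ := Pi.single i 1

/-- The (possibly asymmetric) bilinear form with `B (α i) (α j) = a i j / 2`. -/
def B (A : EGCM ι) : LinearMap.BilinForm ℝ (ι → ℝ) := Matrix.toBilin' ((1 / 2 : ℝ) • A.a)

theorem B_α (A : EGCM ι) (i j : ι) : A.B (A.α i) (A.α j) = 1 / 2 * A.a i j := by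
  simp [B, α, Matrix.toBilin'_single]

theorem two_B_self (A : EGCM ι) (i : ι) : ((2 : ℝ) • A.B (A.α i)) (A.α i) = 2 := by
  simp [B_α, A.diag]

/-- The operator `S i`, given by `S i v = v - 2 B (α i) v • α i` (see `S_apply`). -/
def S (A : EGCM ι) (i : ι) : (ι → ℝ) ≃ₗ[ℝ] (ι → ℝ) := Module.reflection (A.two_B_self i)

theorem S_apply (A : EGCM ι) (i : ι) (v : ι → ℝ) :
    A.S i v = v - (2 * A.B (A.α i) v) • A.α i := by
  simp [S, Module.reflection_apply]

theorem S_mul_S_pow_of_ne (A : EGCM ι) {i j : ι} (hij : i ≠ j) (h0 : A.m i j ≠ 0) :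
    (A.S i * A.S j) ^ A.m i j = 1 := by
  obtain ⟨h2, hcos⟩ := A.m_spec hij h0
  have hfy : ((2 : ℝ) • A.B (A.α i)) (A.α j) = A.a i j := by simp [B_α]
  have hgx : ((2 : ℝ) • A.B (A.α j)) (A.α i) = A.a j i := by simp [B_α]
  generalize A.m i j = N at *
  have hN0 : (N : ℝ) ≠ 0 := by exact_mod_cast h0
  set φ : ℝ := 2 * (Real.pi / N) with hφ
  have ht : 2 * Real.cos φ
      = ((2 : ℝ) • A.B (A.α i)) (A.α j) * ((2 : ℝ) • A.B (A.α j)) (A.α i) - 2 := by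
    rw [hfy, hgx, hcos, hφ, Real.cos_two_mul]; ring
  ext1 v
  have key := Module.reflection_mul_reflection_pow_apply (A.two_B_self i) (A.two_B_self j) N v
    (2 * Real.cos φ) ht
  change ((A.S i * A.S j) ^ N) v = v
  change ((A.S i * A.S j) ^ N) v = _ at key
  rw [key]
  clear key
  rcases Nat.lt_or_ge 2 N with h3 | h3
  · have hs : Real.sin φ ≠ 0 := by
      have hN3 : (3 : ℝ) ≤ N := by exact_mod_cast h3
      have hpos : (0 : ℝ) < N := by linarith
      apply ne_of_gt
      apply Real.sin_pos_of_pos_of_lt_pi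
      · have := Real.pi_pos
        positivity
      · rw [hφ, ← mul_div_assoc, div_lt_iff₀ hpos]
        nlinarith [Real.pi_pos]
    have hS := Polynomial.Chebyshev.S_two_mul_real_cos φ
    rcases Nat.even_or_odd' N with ⟨k, rfl | rfl⟩
    · have e1 : (((2 * k : ℕ) : ℤ) - 2) / 2 = (k : ℤ) - 1 := by omega
      have e2 : (((2 * k : ℕ) : ℤ) - 1) / 2 = (k : ℤ) - 1 := by omega
      have hz : (Polynomial.Chebyshev.S ℝ ((k : ℤ) - 1)).eval (2 * Real.cos φ) = 0 := by
        have := hS ((k : ℤ) - 1)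
        have hk : (k : ℝ) * φ = Real.pi := by
          have hk0 : (k : ℝ) ≠ 0 := by
            intro h
            apply hN0
            push_cast
            rw [h, mul_zero]
          rw [hφ]; push_cast
          field_simp
        push_cast at this
        rw [sub_add_cancel, hk, Real.sin_pi] at this
        exact (mul_eq_zero.mp this).resolve_right hs
      rw [e1, e2, hz]
      simp
    · have e1 : (((2 * k + 1 : ℕ) : ℤ) - 1) / 2 = (k : ℤ) := by omega
      have e2 : (((2 * k + 1 : ℕ) : ℤ) - 3) / 2 = (k : ℤ) - 1 := by omega
      have e3 : (((2 * k + 1 : ℕ) : ℤ)) / 2 = (k : ℤ) := by omega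
      have e4 : (((2 * k + 1 : ℕ) : ℤ) - 2) / 2 = (k : ℤ) - 1 := by omega
      have hz : (Polynomial.Chebyshev.S ℝ (k : ℤ)).eval (2 * Real.cos φ)
          + (Polynomial.Chebyshev.S ℝ ((k : ℤ) - 1)).eval (2 * Real.cos φ) = 0 := by
        have h1 := hS (k : ℤ)
        have h2 := hS ((k : ℤ) - 1)
        have hk : (k : ℝ) * φ = 2 * Real.pi - ((k : ℝ) + 1) * φ := by
          rw [hφ]; push_cast at hN0 ⊢
          field_simp
          ring
        push_cast at h1 h2
        rw [sub_add_cancel, hk, Real.sin_two_pi_sub] at h2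
        have : ((Polynomial.Chebyshev.S ℝ (k : ℤ)).eval (2 * Real.cos φ)
          + (Polynomial.Chebyshev.S ℝ ((k : ℤ) - 1)).eval (2 * Real.cos φ)) * Real.sin φ = 0 := by
          rw [add_mul, h1, h2]; ring
        exact (mul_eq_zero.mp this).resolve_right hs
      rw [e1, e2, e3, e4, hz]
      simp
  · obtain rfl : N = 2 := by omega
    have hprod : A.a i j * A.a j i = 0 := by rw [hcos]; simp
    have hij0 : A.a i j = 0 := by
      by_contra h
      exact mul_ne_zero h (A.ne_zero i j h) hprod
    have hji0 : A.a j i = 0 := by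
      by_contra h
      exact A.ne_zero j i h hij0
    have hcosφ : Real.cos φ = -1 := by
      rw [hfy, hgx, hij0, hji0] at ht
      linarith
    rw [hfy, hgx, hij0, hji0, hcosφ]
    norm_num
    abel

theorem isLiftable_S (A : EGCM ι) : A.coxeterMatrix.IsLiftable A.S := by
  intro i j
  change (A.S i * A.S j) ^ A.m i j = 1
  rcases eq_or_ne i j with rfl | hij
  · have : A.m i i = 1 := by simp [m]
    rw [this, pow_one]
    ext1 v
    exact Module.involutive_reflection (A.two_B_self i) v
  · rcases eq_or_ne (A.m i j) 0 with h0 | h0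
    · rw [h0, pow_zero]
    · exact A.S_mul_S_pow_of_ne hij h0

/-- The geometric representation `σ : W → GL(V)`: the unique homomorphism with `σ (s i) = S i`.
The vector `w.v` is `A.σ w v`. -/
def σ (A : EGCM ι) : A.W →* ((ι → ℝ) ≃ₗ[ℝ] (ι → ℝ)) :=
  A.coxeterMatrix.toCoxeterSystem.lift ⟨A.S, A.isLiftable_S⟩

theorem σ_s (A : EGCM ι) (i : ι) : A.σ (A.s i) = A.S i :=
  A.coxeterMatrix.toCoxeterSystem.lift_apply_simple A.isLiftable_S i

end EGCM

namespace EGCM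

variable {ι : Type*} [DecidableEq ι]

/-- Distinct nodes `i`, `j` are odd-neighborly if `m i j` is (finite and) odd. -/
def OddNeighbor (A : EGCM ι) (i j : ι) : Prop := i ≠ j ∧ Odd (A.m i j)

/-- Distinct nodes `i`, `j` are even-related if `m i j` is finite and even. -/
def EvenRelated (A : EGCM ι) (i j : ι) : Prop := i ≠ j ∧ A.m i j ≠ 0 ∧ Even (A.m i j)

/-- The element `v_{ji}` of `W`: it is `(s i * s j) ^ ((m i j - 1) / 2)` for odd `m i j` and
`s j * (s i * s j) ^ ((m i j - 2) / 2)` for even `m i j`. (Only used for distinct `i`, `j` with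
`m i j` finite, where the divisions and subtractions are exact.) -/
def v (A : EGCM ι) (j i : ι) : A.W :=
  if Odd (A.m i j) then (A.s i * A.s j) ^ ((A.m i j - 1) / 2)
  else A.s j * (A.s i * A.s j) ^ ((A.m i j - 2) / 2)

/-- The number `K_{ji} = - a j i / (2 cos (π / m i j))`. (Only used for odd neighbors.) -/
def K (A : EGCM ι) (j i : ι) : ℝ := -A.a j i / (2 * Real.cos (Real.pi / A.m i j))

/-- A path of odd neighbors (ON-path) `[γ_{i_0}, …, γ_{i_p}]`, of length `p ≥ 0`. -/
structure ONPath (A : EGCM ι) where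
  length : ℕ
  node : Fin (length + 1) → ι
  odd : ∀ k : Fin length, A.OddNeighbor (node k.castSucc) (node k.succ)

/-- A sequence of even-related nodes (ER-sequence) `[(γ_r, γ_{j_1}), …, (γ_r, γ_{j_q})]` rooted
at `r`, possibly empty, recorded as the list `[j_1, …, j_q]`. -/
def ERSeq (A : EGCM ι) (r : ι) : Type _ := {L : List ι // ∀ j ∈ L, A.EvenRelated r j}

/-- The element `w_S = v_{j_q r} ⋯ v_{j_1 r}` of an ER-sequence rooted at `r`. -/
def ERSeq.w {A : EGCM ι} {r : ι} (S : A.ERSeq r) : A.W :=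
  (S.1.map fun j => A.v j r).reverse.prod

namespace ONPath

variable {A : EGCM ι}

/-- The start node `i_0`. -/
def first (P : A.ONPath) : ι := P.node 0

/-- The end node `i_p`. -/
def last (P : A.ONPath) : ι := P.node (Fin.last P.length)

/-- The element `w_P = v_{i_p i_{p-1}} ⋯ v_{i_1 i_0}`. -/
def w (P : A.ONPath) : A.W :=
  (List.ofFn fun k : Fin P.length => A.v (P.node k.succ) (P.node k.castSucc)).reverse.prod

/-- The number `Π_P = K_{i_p i_{p-1}} ⋯ K_{i_1 i_0}`. -/
def prodK (P : A.ONPath) : ℝ :=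
  ∏ k : Fin P.length, A.K (P.node k.succ) (P.node k.castSucc)

/-- The element `w_{S_p} v_{i_p i_{p-1}} w_{S_{p-1}} ⋯ v_{i_2 i_1} w_{S_1} v_{i_1 i_0} w_{S_0}`,
for ER-sequences `S_k` rooted at the nodes `i_k` of the ON-path, `0 ≤ k ≤ p`. -/
def interleave (P : A.ONPath) (S : ∀ k, A.ERSeq (P.node k)) : A.W :=
  (S (Fin.last P.length)).w *
    (List.ofFn fun k : Fin P.length =>
      A.v (P.node k.succ) (P.node k.castSucc) * (S k.castSucc).w).reverse.prod

end ONPath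

end EGCM

end

/-! Suppose `w.α i = K α x` with `K > 0` and `w ≠ 1`. Choose a right descent `j` of `w`. Since roots
have constant sign (`σ_α_nonneg`, `σ_α_nonpos`), `i` is not a right descent, so `j ≠ i`. Factor `w =
u y` with lengths adding, `y` alternating in `s i`, `s j`, and neither `i` nor `j` a descent of `u`.
Then `y.α i = p α i + q α j` with `p, q ≥ 0`, and `u` sends both simple roots to nonnegative
vectors. If `p, q > 0`, both images would lie on the line of `α x`, contradicting injectivity of
`u`. This forces `y` to have length `m i j - 1`, that is `y = v_{ji}`, which fixes `α i` when `m i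
j` is even and sends it to `K_{ji} α j` when it is odd. Induction on length, applied to `u`,
produces the path and the ER-sequences.

The converse evaluates the product factor by factor. The case `K < 0` is the case `K > 0` for `w s
i`. -/

namespace CoxeterSystem

variable {B W : Type*} [Group W] {M : CoxeterMatrix B}

/-! ### Factorization along a rank-two parabolic subgroup -/

/-- If `i` is not a right descent of `w`, then `w = u * x` with lengths adding up, where neither
`i` nor `j` is a right descent of `u` and `x` is an alternating product in `i` and `j` ending
with `j` which is shorter than the longest such product. -/
theorem exists_eq_mul_alternatingWord (cs : CoxeterSystem M W) (w : W) {i j : B} (hij : i ≠ j)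
    (hi : ¬ cs.IsRightDescent w i) :
    ∃ (u : W) (n : ℕ), w = u * cs.wordProd (alternatingWord i j n) ∧
      cs.length u + n = cs.length w ∧
      ¬ cs.IsRightDescent u i ∧ ¬ cs.IsRightDescent u j ∧
      (M i j = 0 ∨ n < M i j) ∧ (cs.IsRightDescent w j → 0 < n) := by
  induction hl : cs.length w using Nat.strong_induction_on generalizing w i j with
  | _ l ih =>
    by_cases hj : cs.IsRightDescent w j
    · have hlen := cs.isRightDescent_iff.1 hj
      obtain ⟨u, n, hw, hn, hu, hu', hnm, -⟩ := ih (cs.length (w * cs.simple j)) (by omega)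
        (w * cs.simple j) hij.symm (cs.isRightDescent_iff_not_isRightDescent_mul.1 hj) rfl
      have hw' : w = u * cs.wordProd (alternatingWord i j (n + 1)) := by
        rw [alternatingWord_succ, wordProd_concat, ← mul_assoc, ← hw,
          simple_mul_simple_cancel_right]
      refine ⟨u, n + 1, hw', by omega, hu', hu, ?_, fun _ => n.succ_pos⟩
      rw [M.symmetric j i] at hnm
      -- At length exactly `M i j` the braid relation would rewrite the alternating factor to end in
      -- `i`, making `i` a right descent of `w`.
      refine hnm.imp_right fun hlt => lt_of_le_of_ne hlt fun heq => hi ?_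
      have hw'' : w * cs.simple i = u * cs.wordProd (alternatingWord i j n) := by
        have hbraid := cs.wordProd_braidWord_eq i j
        rw [braidWord, braidWord, M.symmetric j i, ← heq] at hbraid
        rw [hw', hbraid, alternatingWord_succ, wordProd_concat, ← mul_assoc,
          simple_mul_simple_cancel_right]
      have h1 := cs.length_mul_le u (cs.wordProd (alternatingWord i j n))
      have h2 := cs.length_wordProd_le (alternatingWord i j n)
      rw [length_alternatingWord] at h2
      unfold IsRightDescent
      rw [hw'']
      omega
    · refine ⟨w, 0, by simp [alternatingWord], by omega, hi, hj, ?_, fun h => absurd h hj⟩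
      exact (M i j).eq_zero_or_pos

end CoxeterSystem

noncomputable section

namespace EGCM

/-! ### Chebyshev values and their signs -/

/-- The sequence `0, 1, d, d ^ 2 - 1, …` with `u (n + 2) = d * u (n + 1) - u n`. -/
def chebyshevSeq (d : ℝ) : ℕ → ℝ
  | 0 => 0
  | 1 => 1
  | n + 2 => d * chebyshevSeq d (n + 1) - chebyshevSeq d n

theorem chebyshevSeq_add_two (d : ℝ) (n : ℕ) :
    chebyshevSeq d (n + 2) = d * chebyshevSeq d (n + 1) - chebyshevSeq d n := rfl

theorem chebyshevSeq_two_mul_cos_mul_sin (θ : ℝ) (n : ℕ) :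
    chebyshevSeq (2 * Real.cos θ) n * Real.sin θ = Real.sin (n * θ) := by
  induction n using Nat.twoStepInduction with
  | zero => simp [chebyshevSeq]
  | one => simp [chebyshevSeq]
  | more n h1 h2 =>
    rw [chebyshevSeq_add_two, sub_mul, mul_assoc, h1, h2]
    have e1 : ((n + 2 : ℕ) : ℝ) * θ = ((n + 1 : ℕ) : ℝ) * θ + θ := by push_cast; ring
    have e2 : (n : ℝ) * θ = ((n + 1 : ℕ) : ℝ) * θ - θ := by push_cast; ring
    rw [e1, e2, Real.sin_add, Real.sin_sub]
    ring

theorem chebyshevSeq_lt_succ {d : ℝ} (hd : 2 ≤ d) (n : ℕ) :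
    0 ≤ chebyshevSeq d n ∧ chebyshevSeq d n < chebyshevSeq d (n + 1) := by
  induction n with
  | zero => simp [chebyshevSeq]
  | succ n ih =>
    obtain ⟨h0, h1⟩ := ih
    refine ⟨h0.trans h1.le, ?_⟩
    rw [chebyshevSeq_add_two]
    nlinarith

/-- The `n`-th value is `sin (n π / m) / sin (π / m)`, and the sine is positive strictly between `0`
and `π`. -/
theorem chebyshevSeq_two_mul_cos_pi_div {m : ℕ} (hm : 2 ≤ m) :
    (∀ n, n ≤ m → 0 ≤ chebyshevSeq (2 * Real.cos (Real.pi / m)) n) ∧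
    (∀ n, 0 < n → n < m → 0 < chebyshevSeq (2 * Real.cos (Real.pi / m)) n) ∧
    chebyshevSeq (2 * Real.cos (Real.pi / m)) m = 0 ∧
    chebyshevSeq (2 * Real.cos (Real.pi / m)) (m - 1) = 1 := by
  have hm' : (2 : ℝ) ≤ m := by exact_mod_cast hm
  have hm0 : (0 : ℝ) < m := by linarith
  have hsin : 0 < Real.sin (Real.pi / m) := by
    refine Real.sin_pos_of_pos_of_lt_pi (div_pos Real.pi_pos hm0) ?_
    rw [div_lt_iff₀ hm0]
    nlinarith [Real.pi_pos]
  have key := chebyshevSeq_two_mul_cos_mul_sin (Real.pi / m)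
  have hzero : chebyshevSeq (2 * Real.cos (Real.pi / m)) m = 0 := by
    have := key m
    rw [mul_div_cancel₀ _ hm0.ne', Real.sin_pi] at this
    exact (mul_eq_zero.1 this).resolve_right hsin.ne'
  have hpos : ∀ n, 0 < n → n < m → 0 < chebyshevSeq (2 * Real.cos (Real.pi / m)) n := by
    intro n hn hnm
    have hn' : (0 : ℝ) < n := by exact_mod_cast hn
    have hnm' : (n : ℝ) < m := by exact_mod_cast hnm
    refine pos_of_mul_pos_left ?_ hsin.le
    rw [key]
    refine Real.sin_pos_of_pos_of_lt_pi (mul_pos hn' (div_pos Real.pi_pos hm0)) ?_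
    rw [← mul_div_assoc, div_lt_iff₀ hm0]
    nlinarith [Real.pi_pos]
  refine ⟨fun n hn => ?_, hpos, hzero, ?_⟩
  · rcases hn.eq_or_lt with rfl | hlt
    · exact hzero.ge
    · rcases n.eq_zero_or_pos with rfl | h
      · exact le_rfl
      · exact (hpos n h hlt).le
  · have := key (m - 1)
    rw [Nat.cast_sub (by omega), Nat.cast_one, sub_mul, mul_div_cancel₀ _ hm0.ne', one_mul,
      Real.sin_pi_sub] at this
    exact (mul_eq_right₀ hsin.ne').1 this

section

variable {ι : Type*} [DecidableEq ι]

/-! ### Rank-two constants and the elements `v` -/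

theorem four_le_of_m_eq_zero (A : EGCM ι) {i j : ι} (hij : i ≠ j) (h : A.m i j = 0) :
    4 ≤ A.a i j * A.a j i := by
  refine (A.transpose_mul i j hij).resolve_right fun ⟨k, hk⟩ => ?_
  have hmem := Nat.sInf_mem
    (s := {k : ℕ | 2 ≤ k ∧ A.a i j * A.a j i = 4 * Real.cos (Real.pi / k) ^ 2}) ⟨k, hk⟩
  simp only [m, if_neg hij] at h
  rw [h] at hmem
  exact absurd hmem.1 (by norm_num)

/-- The constants which describe the action of the dihedral group generated by `s i` and `s j`
on `α i`. -/
theorem exists_dihedral_constants (A : EGCM ι) {i j : ι} (hij : i ≠ j) :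
    ∃ d κ : ℝ, κ * d = -A.a j i ∧ -A.a i j * κ = d ∧ 0 ≤ κ ∧
      (A.m i j ≠ 2 → 0 < d ∧ 0 < κ) ∧
      (∀ n, (A.m i j = 0 ∨ n ≤ A.m i j) → 0 ≤ chebyshevSeq d n) ∧
      (∀ n, 0 < n → (A.m i j = 0 ∨ n < A.m i j) → 0 < chebyshevSeq d n) ∧
      (A.m i j ≠ 0 → d = 2 * Real.cos (Real.pi / A.m i j) ∧
        chebyshevSeq d (A.m i j) = 0 ∧ chebyshevSeq d (A.m i j - 1) = 1) := by
  -- `d` is the square root of `a i j * a j i`. When `κ ≠ 0`, it rescales `α j` so that in the basis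
  -- `α i`, `κ α j` both reflections have the same off-diagonal entry `d`. For `m i j = 2` both
  -- matrix entries vanish and `κ = 0` suffices.
  have hneg := A.nonpos i j hij
  have hneg' := A.nonpos j i hij.symm
  rcases eq_or_ne (A.m i j) 0 with h0 | h0
  · have h4 := A.four_le_of_m_eq_zero hij h0
    have hb : A.a j i < 0 := lt_of_le_of_ne hneg' (by rintro h; rw [h] at h4; norm_num at h4)
    have hd : 2 ≤ Real.sqrt (A.a i j * A.a j i) := Real.le_sqrt_of_sq_le (by linarith)
    have hsq := Real.sq_sqrt (show 0 ≤ A.a i j * A.a j i by linarith)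
    set d := Real.sqrt (A.a i j * A.a j i) with hd_def
    have hd0 : 0 < d := by linarith
    have hκ : 0 < -A.a j i / d := div_pos (by linarith) hd0
    have hseq := chebyshevSeq_lt_succ hd
    refine ⟨d, -A.a j i / d, div_mul_cancel₀ _ hd0.ne', ?_, hκ.le, fun _ => ⟨hd0, hκ⟩,
      fun n _ => (hseq n).1, fun n hn _ => ?_, fun h => absurd h0 h⟩
    · rw [mul_div_assoc', neg_mul_neg, ← hsq, pow_two, mul_div_cancel_right₀ _ hd0.ne']
    · obtain ⟨k, rfl⟩ := Nat.exists_eq_succ_of_ne_zero hn.ne'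
      exact (hseq k).1.trans_lt (hseq k).2
  · obtain ⟨h2, hcos⟩ := A.m_spec hij h0
    obtain ⟨hnn, hpos, hz, hone⟩ := chebyshevSeq_two_mul_cos_pi_div h2
    rcases eq_or_ne (A.m i j) 2 with hm2 | hm2
    · have hd : 2 * Real.cos (Real.pi / A.m i j) = 0 := by simp [hm2]
      have hprod : A.a i j * A.a j i = 0 := by rw [hcos, hm2]; simp
      have hji : A.a j i = 0 := by
        by_contra h
        exact mul_ne_zero (A.ne_zero j i h) h hprod
      exact ⟨_, 0, by simp [hji], by simp [hd], le_rfl, fun h => absurd hm2 h,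
        fun n hn => hnn n (hn.resolve_left h0), fun n hn hn' => hpos n hn (hn'.resolve_left h0),
        fun _ => ⟨rfl, hz, hone⟩⟩
    · have hm3 : (3 : ℝ) ≤ A.m i j := by exact_mod_cast (show 3 ≤ A.m i j by omega)
      have hd0 : 0 < 2 * Real.cos (Real.pi / A.m i j) := by
        refine mul_pos two_pos (Real.cos_pos_of_mem_Ioo ⟨?_, ?_⟩)
        · have : 0 < Real.pi / A.m i j := div_pos Real.pi_pos (by linarith)
          linarith [Real.pi_pos]
        · rw [div_lt_iff₀ (by linarith)]
          nlinarith [Real.pi_pos]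
      have hab : A.a i j * A.a j i = (2 * Real.cos (Real.pi / A.m i j)) ^ 2 := by
        rw [hcos]; ring
      set d := 2 * Real.cos (Real.pi / A.m i j) with hd_def
      have hb : A.a j i < 0 := lt_of_le_of_ne hneg' (by
        rintro h
        rw [h, mul_zero] at hab
        exact (pow_pos hd0 2).ne hab)
      have hκ : 0 < -A.a j i / d := div_pos (by linarith) hd0
      refine ⟨d, -A.a j i / d, div_mul_cancel₀ _ hd0.ne', ?_, hκ.le, fun _ => ⟨hd0, hκ⟩,
        fun n hn => hnn n (hn.resolve_left h0), fun n hn hn' => hpos n hn (hn'.resolve_left h0),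
        fun _ => ⟨rfl, hz, hone⟩⟩
      rw [mul_div_assoc', neg_mul_neg, hab, pow_two, mul_div_cancel_right₀ _ hd0.ne']

/-- The Coxeter system of `A`. -/
abbrev cs (A : EGCM ι) : CoxeterSystem A.coxeterMatrix A.W := A.coxeterMatrix.toCoxeterSystem

/-- Treats both parities at once: `v` is the alternating product one letter short of the braid word.
-/
theorem v_eq_wordProd (A : EGCM ι) {i j : ι} (h0 : A.m i j ≠ 0) :
    A.v j i = A.cs.wordProd (CoxeterSystem.alternatingWord i j (A.m i j - 1)) := by
  rw [CoxeterSystem.prod_alternatingWord_eq_mul_pow, v]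
  by_cases h : Odd (A.m i j)
  · have he : Even (A.m i j - 1) := by grind
    rw [if_pos h, if_pos he, one_mul]
    rfl
  · have he : ¬ Even (A.m i j - 1) := by grind
    have hdiv : (A.m i j - 1) / 2 = (A.m i j - 2) / 2 := by grind
    rw [if_neg h, if_neg he, hdiv]
    rfl

theorem OddNeighbor.m_ne_zero {A : EGCM ι} {i j : ι} (h : A.OddNeighbor i j) : A.m i j ≠ 0 := by
  intro h0
  have := h.2
  rw [h0] at this
  exact absurd this (by decide)

theorem α_ne_zero (A : EGCM ι) (i : ι) : A.α i ≠ 0 := by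
  simp [α]

theorem eq_smul_α (A : EGCM ι) {x : ι} {f : ι → ℝ}
    (h : ∀ y, y ≠ x → f y = 0) : f = f x • A.α x := by
  ext y
  rcases eq_or_ne y x with rfl | hy
  · simp [α]
  · simp [α, h y hy, hy]

theorem smul_α_left_injective (A : EGCM ι) (x : ι) {K K' : ℝ} (h : K • A.α x = K' • A.α x) :
    K = K' :=
  smul_left_injective ℝ (A.α_ne_zero x) h

/-! ### Products along ON-paths -/

/-- `A.IsTransport i x w` says that `w` is a product of elements `v_{ji}` along an ON-path from
`i` to `x`, with elements of ER-sequences inserted at the nodes. -/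
inductive IsTransport (A : EGCM ι) : ι → ι → A.W → Prop
  | one (i : ι) : IsTransport A i i 1
  | even {i j x : ι} {w : A.W} (h : A.EvenRelated i j) (hw : IsTransport A i x w) :
      IsTransport A i x (w * A.v j i)
  | odd {i j x : ι} {w : A.W} (h : A.OddNeighbor i j) (hw : IsTransport A j x w) :
      IsTransport A i x (w * A.v j i)

/-- The path of length `0`. -/
def ONPath.nil (A : EGCM ι) (i : ι) : A.ONPath := ⟨0, fun _ => i, fun k => k.elim0⟩

/-- The path `P` with an odd neighbor of its start node put in front. -/
def ONPath.cons {A : EGCM ι} (P : A.ONPath) {i : ι} (h : A.OddNeighbor i P.first) : A.ONPath where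
  length := P.length + 1
  node := Fin.cons i P.node
  odd := Fin.cases h P.odd

theorem IsTransport.exists_path {A : EGCM ι} {i x : ι} {w : A.W} (h : A.IsTransport i x w) :
    ∃ P : A.ONPath, P.first = i ∧ P.last = x ∧
      ∃ S : ∀ k, A.ERSeq (P.node k), w = P.interleave S := by
  induction h with
  | one i =>
    exact ⟨.nil A i, rfl, rfl, fun _ => ⟨[], by simp⟩, by
      simp [ONPath.interleave, ONPath.nil, ERSeq.w]⟩
  | @even i j x w h hw ih =>
    obtain ⟨⟨n, node, odd⟩, rfl, rfl, S, rfl⟩ := ih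
    refine ⟨⟨n, node, odd⟩, rfl, rfl,
      Fin.cases ⟨j :: (S 0).1, List.forall_mem_cons.2 ⟨h, (S 0).2⟩⟩ fun k => S k.succ, ?_⟩
    -- For length `0` the element of `S 0` is the separate leading factor of `interleave`; otherwise
    -- it sits in the last factor of the product.
    cases n with
    | zero =>
      simp only [ONPath.interleave, List.ofFn_zero, List.reverse_nil, List.prod_nil, mul_one]
      change (S 0).w * A.v j (node 0) = ERSeq.w _
      simp only [ERSeq.w]
      change _ = (List.map _ (j :: (S 0).1)).reverse.prod
      simp
    | succ n =>
      simp only [ONPath.interleave, List.ofFn_succ, List.reverse_cons, List.prod_append,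
        List.prod_singleton, mul_assoc]
      have h0 : ERSeq.w (A := A) (r := node 0)
          ⟨j :: (S 0).1, List.forall_mem_cons.2 ⟨h, (S 0).2⟩⟩ = (S 0).w * A.v j (node 0) := by
        simp [ERSeq.w]
      change _ = _ * (_ * (_ * ERSeq.w (A := A) (r := node 0)
          ⟨j :: (S 0).1, List.forall_mem_cons.2 ⟨h, (S 0).2⟩⟩))
      rw [h0]
      rfl
  | @odd i j x w h hw ih =>
    obtain ⟨P, rfl, rfl, S, rfl⟩ := ih
    refine ⟨P.cons h, rfl, rfl, Fin.cases ⟨[], by simp⟩ S, ?_⟩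
    simp only [ONPath.interleave, ONPath.cons, List.ofFn_succ, List.reverse_cons,
      List.prod_append, List.prod_singleton, mul_assoc]
    have h0 : ERSeq.w (A := A) (r := i) ⟨[], by simp⟩ = 1 := by simp [ERSeq.w]
    change _ = _ * (_ * (_ * ERSeq.w (A := A) (r := i) ⟨[], by simp⟩))
    rw [h0, mul_one]
    rfl

variable [Fintype ι]

/-! ### Dihedral action on simple roots -/

theorem S_α_self (A : EGCM ι) (i : ι) : A.S i (A.α i) = -A.α i := by
  rw [S_apply, B_α, A.diag]
  module

theorem S_α (A : EGCM ι) (i j : ι) : A.S i (A.α j) = A.α j - A.a i j • A.α i := by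
  rw [S_apply, B_α]
  module

theorem σ_s_α_self (A : EGCM ι) (i : ι) : A.σ (A.s i) (A.α i) = -A.α i := by
  rw [σ_s, S_α_self]

theorem σ_mul_apply (A : EGCM ι) (w w' : A.W) (x : ι → ℝ) : A.σ (w * w') x = A.σ w (A.σ w' x) := by
  rw [map_mul]
  rfl

/-- Each letter prepended changes one coordinate with respect to `α i`, `κ α j`, by one step of the
Chebyshev recursion. -/
theorem σ_wordProd_alternatingWord (A : EGCM ι) {i j : ι} {d κ : ℝ}
    (h1 : κ * d = -A.a j i) (h2 : -A.a i j * κ = d) (n : ℕ) :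
    A.σ (A.cs.wordProd (CoxeterSystem.alternatingWord i j n)) (A.α i) =
      if Even n then chebyshevSeq d (n + 1) • A.α i + (κ * chebyshevSeq d n) • A.α j
      else chebyshevSeq d n • A.α i + (κ * chebyshevSeq d (n + 1)) • A.α j := by
  induction n with
  | zero => simp [CoxeterSystem.alternatingWord, chebyshevSeq]
  | succ n ih =>
    rw [CoxeterSystem.alternatingWord_succ', CoxeterSystem.wordProd_cons, σ_mul_apply, ih]
    have hs : ∀ k, A.σ (A.cs.simple k) = A.S k := A.σ_s
    by_cases hn : Even n
    · have hn' : ¬ Even (n + 1) := by grind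
      rw [if_pos hn, if_pos hn, if_neg hn', hs, map_add, map_smul, map_smul, S_α, S_α_self,
        chebyshevSeq_add_two, mul_sub, ← mul_assoc, h1]
      module
    · have hn' : Even (n + 1) := by grind
      rw [if_neg hn, if_neg hn, if_pos hn', hs, map_add, map_smul, map_smul, S_α_self, S_α,
        chebyshevSeq_add_two, ← h2]
      module

/-- At length `m i j - 1` the two coordinates are the Chebyshev values `1` and `0`; parity decides
which simple root survives. -/
theorem σ_v_of_even (A : EGCM ι) {i j : ι} (h : A.EvenRelated i j) :
    A.σ (A.v j i) (A.α i) = A.α i := by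
  obtain ⟨hij, h0, he⟩ := h
  obtain ⟨d, κ, h1, h2, -, -, -, -, hm⟩ := A.exists_dihedral_constants hij
  obtain ⟨-, hz, hone⟩ := hm h0
  have hodd : ¬ Even (A.m i j - 1) := by grind
  rw [A.v_eq_wordProd h0, A.σ_wordProd_alternatingWord h1 h2, if_neg hodd, hone,
    Nat.sub_add_cancel (by omega), hz]
  simp

theorem σ_v_of_odd (A : EGCM ι) {i j : ι} (h : A.OddNeighbor i j) :
    0 < A.K j i ∧ A.σ (A.v j i) (A.α i) = A.K j i • A.α j := by
  have h0 := h.m_ne_zero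
  obtain ⟨hij, ho⟩ := h
  obtain ⟨d, κ, h1, h2, -, hpos, -, -, hm⟩ := A.exists_dihedral_constants hij
  obtain ⟨hd, hz, hone⟩ := hm h0
  obtain ⟨hd0, hκ⟩ := hpos (by rintro h; rw [h] at ho; exact absurd ho (by decide))
  have hK : A.K j i = κ := by rw [K, ← hd, ← h1, mul_div_cancel_right₀ _ hd0.ne']
  have heven : Even (A.m i j - 1) := by grind
  refine ⟨hK ▸ hκ, ?_⟩
  rw [A.v_eq_wordProd h0, A.σ_wordProd_alternatingWord h1 h2, if_pos heven, hone,
    Nat.sub_add_cancel (by omega), hz, hK]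
  simp

/-- An alternating product which is shorter than the longest one sends `α i` to a combination
of `α i` and `α j` with nonnegative coefficients, which are positive unless the product is
trivial or one letter short of the longest one. -/
theorem exists_σ_wordProd_alternatingWord (A : EGCM ι) {i j : ι} (hij : i ≠ j) {n : ℕ}
    (hn : A.m i j = 0 ∨ n < A.m i j) :
    ∃ p q : ℝ, A.σ (A.cs.wordProd (CoxeterSystem.alternatingWord i j n)) (A.α i) =
        p • A.α i + q • A.α j ∧ 0 ≤ p ∧ 0 ≤ q ∧
      (0 < n → (A.m i j = 0 ∨ n + 1 < A.m i j) → 0 < p ∧ 0 < q) := by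
  obtain ⟨d, κ, h1, h2, hκ, hm2, hnn, hpos, -⟩ := A.exists_dihedral_constants hij
  have ha := hnn n (hn.imp_right le_of_lt)
  have hb := hnn (n + 1) hn
  have hκ' : 0 < n → (A.m i j = 0 ∨ n + 1 < A.m i j) → 0 < κ := fun h h' => (hm2 (by omega)).2
  rw [A.σ_wordProd_alternatingWord h1 h2]
  by_cases he : Even n
  · rw [if_pos he]
    exact ⟨_, _, rfl, hb, mul_nonneg hκ ha, fun h h' => ⟨hpos _ n.succ_pos h',
      mul_pos (hκ' h h') (hpos n h hn)⟩⟩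
  · rw [if_neg he]
    exact ⟨_, _, rfl, ha, mul_nonneg hκ hb, fun h h' => ⟨hpos n h hn,
      mul_pos (hκ' h h') (hpos _ n.succ_pos h')⟩⟩

/-! ### Sign of roots -/

/-- Splitting off an alternating factor turns `w.α i` into a nonnegative combination of `u.α i` and
`u.α j`, with `u` shorter and without descents at `i`, `j`. -/
theorem σ_α_nonneg (A : EGCM ι) (w : A.W) (i : ι) (hi : ¬ A.cs.IsRightDescent w i) :
    0 ≤ A.σ w (A.α i) := by
  induction hl : A.cs.length w using Nat.strong_induction_on generalizing w i with
  | _ l ih =>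
    rcases eq_or_ne w 1 with rfl | hw
    · rw [map_one]
      exact Pi.single_nonneg.2 zero_le_one
    · obtain ⟨j, hj⟩ := A.cs.exists_rightDescent_of_ne_one hw
      have hij : i ≠ j := by rintro rfl; exact hi hj
      obtain ⟨u, n, hu, hlen, hui, huj, hn, hn0⟩ := A.cs.exists_eq_mul_alternatingWord w hij hi
      obtain ⟨p, q, hpq, hp, hq, -⟩ := A.exists_σ_wordProd_alternatingWord hij hn
      have hlt : A.cs.length u < l := by
        have := hn0 hj
        omega
      rw [hu, σ_mul_apply, hpq, map_add, map_smul, map_smul]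
      exact add_nonneg (smul_nonneg hp (ih _ hlt u i hui rfl))
        (smul_nonneg hq (ih _ hlt u j huj rfl))

theorem σ_α_nonpos (A : EGCM ι) (w : A.W) (i : ι) (hi : A.cs.IsRightDescent w i) :
    A.σ w (A.α i) ≤ 0 := by
  have h := A.σ_α_nonneg (w * A.s i) i (A.cs.isRightDescent_iff_not_isRightDescent_mul.1 hi)
  rw [σ_mul_apply, σ_s_α_self, map_neg] at h
  exact neg_nonneg.1 h

/-- Nonproportional roots cannot both be sent to nonnegative vectors which have a positive
combination on a coordinate axis. -/
theorem σ_comb_ne_smul_α (A : EGCM ι) {u : A.W} {i j x : ι} (hij : i ≠ j)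
    (hi : 0 ≤ A.σ u (A.α i)) (hj : 0 ≤ A.σ u (A.α j)) {p q K : ℝ} (hp : 0 < p) (hq : 0 < q) :
    p • A.σ u (A.α i) + q • A.σ u (A.α j) ≠ K • A.α x := by
  intro h
  have hzero : ∀ y, y ≠ x → A.σ u (A.α i) y = 0 ∧ A.σ u (A.α j) y = 0 := by
    intro y hy
    have hsum := congrFun h y
    simp only [Pi.add_apply, Pi.smul_apply, smul_eq_mul, α, Pi.single_eq_of_ne hy,
      mul_zero] at hsum
    have h1 : 0 ≤ A.σ u (A.α i) y := hi y
    have h2 : 0 ≤ A.σ u (A.α j) y := hj y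
    obtain ⟨h3, h4⟩ := (add_eq_zero_iff_of_nonneg (mul_nonneg hp.le h1)
      (mul_nonneg hq.le h2)).1 hsum
    exact ⟨(mul_eq_zero.1 h3).resolve_left hp.ne', (mul_eq_zero.1 h4).resolve_left hq.ne'⟩
  have ei := A.eq_smul_α fun y hy => (hzero y hy).1
  have ej := A.eq_smul_α fun y hy => (hzero y hy).2
  generalize A.σ u (A.α i) x = c at ei
  generalize A.σ u (A.α j) x = e at ej
  -- Both images are multiples `c`, `e` of `α x`, so this combination is killed by `u`. Injectivity
  -- gives `c = 0`, hence `u.α i = 0`, which is absurd.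
  have hker : A.σ u (e • A.α i - c • A.α j) = 0 := by
    rw [map_sub, map_smul, map_smul, ei, ej]
    module
  have hv := (A.σ u).map_eq_zero_iff.1 hker
  have hc : c = 0 := by simpa [α, hij] using congrFun hv j
  rw [hc, zero_smul] at ei
  exact A.α_ne_zero i ((A.σ u).map_eq_zero_iff.1 ei)

/-! ### From proportional roots to paths, and back -/

theorem isTransport_of_σ_α_eq (A : EGCM ι) (w : A.W) (i x : ι) {K : ℝ} (hK : 0 < K)
    (h : A.σ w (A.α i) = K • A.α x) : A.IsTransport i x w := by
  induction hl : A.cs.length w using Nat.strong_induction_on generalizing w i K with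
  | _ l ih =>
    rcases eq_or_ne w 1 with rfl | hw
    · obtain rfl : i = x := by
        by_contra hne
        have := congrFun h i
        simp [α, hne] at this
      exact .one i
    · have hi : ¬ A.cs.IsRightDescent w i := by
        intro hi
        have := A.σ_α_nonpos w i hi x
        rw [h] at this
        simp [α] at this
        linarith
      obtain ⟨j, hj⟩ := A.cs.exists_rightDescent_of_ne_one hw
      have hij : i ≠ j := by rintro rfl; exact hi hj
      obtain ⟨u, n, hu, hlen, hui, huj, hn, hn0⟩ := A.cs.exists_eq_mul_alternatingWord w hij hi
      obtain ⟨p, q, hpq, -, -, hpos⟩ := A.exists_σ_wordProd_alternatingWord hij hn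
      replace hn0 := hn0 hj
      have hlt : A.cs.length u < l := by omega
      -- Any shorter alternating factor has both coefficients positive, which is excluded; so `n = m
      -- i j - 1`.
      have hlast : ¬ (A.m i j = 0 ∨ n + 1 < A.m i j) := by
        intro hm
        obtain ⟨hp, hq⟩ := hpos hn0 hm
        rw [hu, σ_mul_apply, hpq, map_add, map_smul, map_smul] at h
        exact A.σ_comb_ne_smul_α hij (A.σ_α_nonneg u i hui) (A.σ_α_nonneg u j huj) hp hq h
      rw [not_or] at hlast
      have hnm : n = A.m i j - 1 := by
        have := hn.resolve_left hlast.1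
        change n < A.m i j at this
        omega
      rw [hnm, ← A.v_eq_wordProd hlast.1] at hu
      subst hu
      rw [σ_mul_apply] at h
      rcases Nat.even_or_odd (A.m i j) with he | ho
      · have her : A.EvenRelated i j := ⟨hij, hlast.1, he⟩
        rw [A.σ_v_of_even her] at h
        exact .even her (ih _ hlt u i hK h rfl)
      · have hon : A.OddNeighbor i j := ⟨hij, ho⟩
        obtain ⟨hK', hv⟩ := A.σ_v_of_odd hon
        rw [hv, map_smul] at h
        refine .odd hon (ih _ hlt u j (K := (A.K j i)⁻¹ * K) (by positivity) ?_ rfl)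
        rw [mul_smul, ← h, inv_smul_smul₀ hK'.ne']

theorem ERSeq.σ_w {A : EGCM ι} {r : ι} (S : A.ERSeq r) : A.σ S.w (A.α r) = A.α r := by
  obtain ⟨L, hL⟩ := S
  induction L with
  | nil => simp [ERSeq.w]
  | cons j L ih =>
    rw [List.forall_mem_cons] at hL
    have := ih hL.2
    simp only [ERSeq.w, List.map_cons, List.reverse_cons, List.prod_append,
      List.prod_singleton] at this ⊢
    rw [σ_mul_apply, A.σ_v_of_even hL.1, this]

/-- ER-factors fix the simple root of the current node; each `v` moves it along one edge and
contributes its `K`. -/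
theorem ONPath.σ_interleave {A : EGCM ι} (P : A.ONPath) (S : ∀ k, A.ERSeq (P.node k)) :
    A.σ (P.interleave S) (A.α P.first) = P.prodK • A.α P.last := by
  obtain ⟨n, node, odd⟩ := P
  induction n with
  | zero =>
    simp only [ONPath.interleave, List.ofFn_zero, List.reverse_nil, List.prod_nil, mul_one,
      ONPath.prodK, Finset.univ_eq_empty, Finset.prod_empty, one_smul]
    exact (S 0).σ_w
  | succ n ih =>
    have key := ih (fun k => node k.succ) (fun k => odd k.succ) fun k => S k.succ
    simp only [ONPath.interleave, ONPath.prodK, ONPath.first, ONPath.last] at key ⊢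
    rw [List.ofFn_succ, List.reverse_cons, List.prod_append, List.prod_singleton, ← mul_assoc,
      σ_mul_apply, σ_mul_apply, σ_mul_apply, Fin.prod_univ_succ]
    have h0 : A.σ (S (Fin.castSucc 0)).w (A.α (node 0)) = A.α (node 0) := (S 0).σ_w
    have h1 : A.σ (A.v (node (Fin.succ 0)) (node (Fin.castSucc 0))) (A.α (node 0)) = _ :=
      (A.σ_v_of_odd (odd 0)).2
    rw [h0, h1, map_smul, map_smul, mul_smul]
    rw [σ_mul_apply] at key
    exact congrArg _ key

theorem ONPath.σ_w {A : EGCM ι} (P : A.ONPath) :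
    A.σ P.w (A.α P.first) = P.prodK • A.α P.last := by
  have h := P.σ_interleave fun _ => ⟨[], by simp⟩
  simpa [ONPath.interleave, ERSeq.w, ONPath.w] using h

theorem ONPath.prodK_pos {A : EGCM ι} (P : A.ONPath) : 0 < P.prodK :=
  Finset.prod_pos fun k _ => (A.σ_v_of_odd (P.odd k)).1

end

end EGCM

end

theorem theorem3p2 {ι : Type*} [Fintype ι] [DecidableEq ι] (A : EGCM ι)
    (w : A.W) (hw : w ≠ 1) (i : ι) :
    (∀ x : ι,
      ((∃ K : ℝ, 0 < K ∧ A.σ w (A.α i) = K • A.α x) ↔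
        ∃ P : A.ONPath, P.first = i ∧ P.last = x ∧
          ∃ S : ∀ k, A.ERSeq (P.node k), w = P.interleave S) ∧
      (∀ (P : A.ONPath) (S : ∀ k, A.ERSeq (P.node k)),
        P.first = i → P.last = x → w = P.interleave S →
          A.σ w (A.α i) = A.σ P.w (A.α i) ∧
          A.σ w (A.α i) = P.prodK • A.α x ∧
          ∀ K : ℝ, A.σ w (A.α i) = K • A.α x → K = P.prodK)) ∧
    (∀ x : ι,
      ((∃ K : ℝ, K < 0 ∧ A.σ w (A.α i) = K • A.α x) ↔
        ∃ P : A.ONPath, P.first = i ∧ P.last = x ∧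
          ∃ S : ∀ k, A.ERSeq (P.node k), w = P.interleave S * A.s i) ∧
      (∀ (P : A.ONPath) (S : ∀ k, A.ERSeq (P.node k)),
        P.first = i → P.last = x → w = P.interleave S * A.s i →
          A.σ w (A.α i) = A.σ (P.w * A.s i) (A.α i) ∧
          A.σ w (A.α i) = (-P.prodK) • A.α x ∧
          ∀ K : ℝ, A.σ w (A.α i) = K • A.α x → K = -P.prodK)) := by
  refine ⟨fun x => ⟨⟨?_, ?_⟩, ?_⟩, fun x => ⟨⟨?_, ?_⟩, ?_⟩⟩
  · rintro ⟨K, hK, h⟩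
    exact (A.isTransport_of_σ_α_eq w i x hK h).exists_path
  · rintro ⟨P, rfl, rfl, S, rfl⟩
    exact ⟨_, P.prodK_pos, P.σ_interleave S⟩
  · rintro P S rfl rfl rfl
    rw [P.σ_interleave S, P.σ_w]
    exact ⟨rfl, rfl, fun K h => (A.smul_α_left_injective _ h).symm⟩
  · rintro ⟨K, hK, h⟩
    -- `s i` negates `α i`, so `w s i` falls under the positive case, which also covers `w s i = 1`.
    have h' : A.σ (w * A.s i) (A.α i) = (-K) • A.α x := by
      rw [A.σ_mul_apply, A.σ_s_α_self, map_neg, h, neg_smul]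
    obtain ⟨P, hP, hP', S, hS⟩ :=
      (A.isTransport_of_σ_α_eq _ i x (neg_pos.2 hK) h').exists_path
    exact ⟨P, hP, hP', S, by rw [← hS]; exact (A.cs.simple_mul_simple_cancel_right i).symm⟩
  · rintro ⟨P, rfl, rfl, S, rfl⟩
    refine ⟨-P.prodK, neg_neg_of_pos P.prodK_pos, ?_⟩
    rw [A.σ_mul_apply, A.σ_s_α_self, map_neg, P.σ_interleave S, neg_smul]
  · rintro P S rfl rfl rfl
    have h (u : A.W) (hu : A.σ u (A.α P.first) = P.prodK • A.α P.last) :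
        A.σ (u * A.s P.first) (A.α P.first) = (-P.prodK) • A.α P.last := by
      rw [A.σ_mul_apply, A.σ_s_α_self, map_neg, hu, neg_smul]
    rw [h _ (P.σ_interleave S), h _ P.σ_w]
    exact ⟨rfl, rfl, fun K hK => (A.smul_α_left_injective _ hK).symm⟩
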